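/- Let $k$ be an algebraically closed field, $n\ge 0$, and let $H=(k^\times)^n$ with its Zariski topology. For a group $H$ acting by automorphisms on a commutative ring $R$, a subgroup $G\le H$ and an ideal $I$ of $R$, put $(I:G)=\bigcap_{g\in G}g(I)$; let $\max R$ be the set of maximal ideals of $R$, and let $G\text{-}\max R$ be the set of maximal members of the set of proper ideals $I$ with $g(I)=I$ for all $g\in G$. In both parts below, $H$ acts on the ring in question by $k$-algebra automorphisms via $(h_1,\dots,h_n).f(y_1,\dots,y_n)=f(h_1y_1,\dots,h_ny_n)$. (A) Let $R=k[y_1^{\pm1},\dots,y_n^{\pm1}]$ and let $G$ be a closed subgroup of $H$. Then $M\mapsto (M:G)$ maps $\max R$ into $G\text{-}\max R$, and the fibres of this map over the points of $G\text{-}\max R$ are precisely the $G$-orbits in $\max R$. (B) Let $R=k[y_1,\dots,y_n]$. For $w\subseteq\{1,\dots,n\}$ let $\operatorname{spec}_wR$ be the set of prime ideals $P$ of $R$ with $P\cap\{y_1,\dots,y_n\}=\{y_i\mid i\in w\}$, put $\max_wR=\max R\cap\operatorname{spec}_wR$ and $H_w=\{h\in H\mid h_j=1\text{ for all }j\notin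 w\}$. Let $\mathcal G=\{G_w\mid w\subseteq\{1,\dots,n\}\}$ be a family of subgroups of $H$ such that $(P:G_v)\subseteq(P:G_w)$ for all $v\subseteq w$ and all $P\in\operatorname{spec}_wR$. Put $\mathcal G\text{-}\max_wR=\{(M:G_w)\mid M\in\max_wR\}$, call an ideal $\mathcal G$-prime if it equals $(P:G_w)$ for some $w$ and some $P\in\operatorname{spec}_wR$, and $\mathcal G$-semiprime if it is an intersection of a collection of $\mathcal G$-prime ideals (the empty intersection being $R$). For a prime ideal $P$ let $(P:\mathcal G)$ denote the largest $\mathcal G$-semiprime ideal contained in $P$. Fix $w$, and suppose that $G_w\supseteq H_w$ and that $G_w/H_w$ is closed in $H/H_w$ (with the quotient of the Zariski topology). Then for every $M\in\max_wR$ the ideal $(M:\mathcal G)$ exists, $M\mapsto(M:\mathcal G)$ maps $\max_wR$ into $\mathcal G\text{-}\max_wR$, and the fibres of this map over the points of $\mathcal G\text{-}\max_wR$ are precisely the $G_w$-orbits in $\max_wR$. -/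

import Mathlib

open scoped Topology

namespace QuantumSpace

/-- The algebraic torus `H = (kˣ)ⁿ`. -/
abbrev Torus (k : Type*) [Field k] (n : ℕ) : Type _ := Fin n → kˣ

section Zariski

variable {k : Type*} [Field k] {n : ℕ}

/-- The common zeros in the torus of a set of polynomials. -/
def torusZeros (S : Set (MvPolynomial (Fin n) k)) : Set (Torus k n) :=
  {h | ∀ f ∈ S, MvPolynomial.eval (fun i => (h i : k)) f = 0}

variable (k n) in
/-- The Zariski topology on `(kˣ)ⁿ`: the closed sets are the zero sets of polynomials
(equivalently, of Laurent polynomials, since monomials do not vanish on the torus). -/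
abbrev zariskiTopology : TopologicalSpace (Torus k n) :=
  TopologicalSpace.ofClosed {Z | ∃ S : Set (MvPolynomial (Fin n) k), Z = torusZeros S}
    ⟨{1}, by ext h; simp [torusZeros]⟩
    (by
      intro A hA
      refine ⟨{f | ∀ h ∈ ⋂₀ A, MvPolynomial.eval (fun i => (h i : k)) f = 0}, ?_⟩
      ext h
      constructor
      · intro hh f hf
        exact hf h hh
      · intro hh Z hZ
        obtain ⟨S, rfl⟩ := hA hZ
        intro f hf
        exact hh f fun h' hh' => hh' _ hZ f hf)
    (by
      rintro _ ⟨S, rfl⟩ _ ⟨T, rfl⟩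
      refine ⟨{p | ∃ f ∈ S, ∃ g ∈ T, p = f * g}, ?_⟩
      ext h
      constructor
      · rintro (hh | hh) _ ⟨f, hf, g, hg, rfl⟩
        · simp [hh f hf]
        · simp [hh g hg]
      · intro hh
        by_contra hc
        simp only [Set.mem_union, not_or, torusZeros, Set.mem_ofPred_eq, not_forall] at hc
        obtain ⟨⟨f, hf, hf0⟩, g, hg, hg0⟩ := hc
        have := hh _ ⟨f, hf, g, hg, rfl⟩
        rw [map_mul] at this
        exact (mul_ne_zero hf0 hg0) this)

/-- For a subgroup `N` of the torus, the Zariski topology on `H / N`, that is, the quotient of the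
Zariski topology on `H`. -/
abbrev quotientZariskiTopology (N : Subgroup (Torus k n)) : TopologicalSpace (Torus k n ⧸ N) :=
  (zariskiTopology k n).coinduced (QuotientGroup.mk' N)

end Zariski

section Actions

variable {k H R : Type*} [Field k] [Group H] [CommRing R] [Algebra k R]

/-- `(I : G) = ⋂_{g ∈ G} g(I)`, for a group `H` acting on `R` by algebra automorphisms through
`ρ`, a subgroup `G` of `H`, and an ideal `I` of `R`. -/
def colon (ρ : H →* (R ≃ₐ[k] R)) (G : Subgroup H) (I : Ideal R) : Ideal R :=
  ⨅ g ∈ G, I.map (ρ g)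

/-- `I` is a `G`-ideal: `g(I) = I` for all `g ∈ G`. -/
def IsGIdeal (ρ : H →* (R ≃ₐ[k] R)) (G : Subgroup H) (I : Ideal R) : Prop :=
  ∀ g ∈ G, I.map (ρ g) = I

/-- `G-max R`: the set of maximal proper `G`-ideals. -/
def gMax (ρ : H →* (R ≃ₐ[k] R)) (G : Subgroup H) : Set (Ideal R) :=
  {Q | Maximal (fun I => IsGIdeal ρ G I ∧ I ≠ ⊤) Q}

/-- The `G`-orbit of an ideal. -/
def orbit (ρ : H →* (R ≃ₐ[k] R)) (G : Subgroup H) (I : Ideal R) : Set (Ideal R) :=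
  {J | ∃ g ∈ G, J = I.map (ρ g)}

/-- The set of `G`-orbits of members of `s`. -/
def orbits (ρ : H →* (R ≃ₐ[k] R)) (G : Subgroup H) (s : Set (Ideal R)) : Set (Set (Ideal R)) :=
  {F | ∃ M ∈ s, F = orbit ρ G M}

/-- The set of fibres, over the points of `t`, of the map `s → t` given by `f`. -/
def fibers {α β : Type*} (f : α → β) (s : Set α) (t : Set β) : Set (Set α) :=
  {F | ∃ Q ∈ t, F = {M | M ∈ s ∧ f M = Q}}

variable (R) in
/-- `max R`. -/
def maxIdeals : Set (Ideal R) := {M | M.IsMaximal}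

end Actions

section Laurent

variable {k : Type*} [Field k] {n : ℕ}

variable (k n) in
/-- The Laurent polynomial ring `k[y₁^{±1}, …, yₙ^{±1}]`, as the group algebra of `ℤⁿ`:
`single α c` is the term `c y^α`. -/
abbrev Laurent : Type _ := AddMonoidAlgebra k (Fin n → ℤ)

/-- The algebra endomorphism `f(y₁, …, yₙ) ↦ f(h₁y₁, …, hₙyₙ)` of the Laurent polynomial ring,
with `y^α ↦ (∏ hᵢ^{αᵢ}) y^α`. -/
noncomputable def laurentHom (h : Torus k n) : Laurent k n →ₐ[k] Laurent k n :=
  AddMonoidAlgebra.lift k (Laurent k n) (Fin n → ℤ)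
    { toFun := fun α =>
        AddMonoidAlgebra.single α.toAdd ((∏ i, h i ^ (α.toAdd i) : kˣ) : k)
      map_one' := by simp [AddMonoidAlgebra.one_def]
      map_mul' := fun α β => by
        simp [AddMonoidAlgebra.single_mul_single, zpow_add₀, Finset.prod_mul_distrib] }

theorem laurentHom_single (h : Torus k n) (α : Fin n → ℤ) (c : k) :
    laurentHom h (AddMonoidAlgebra.single α c) =
      AddMonoidAlgebra.single α (c * ((∏ i, h i ^ α i : kˣ) : k)) := by
  simp [laurentHom, AddMonoidAlgebra.lift_single]

theorem laurentHom_one : laurentHom (1 : Torus k n) = AlgHom.id k _ := by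
  apply AddMonoidAlgebra.algHom_ext
  · intro α
    simp [laurentHom_single]
  · exact Subsingleton.elim _ _

theorem laurentHom_mul (g h : Torus k n) :
    laurentHom (g * h) = (laurentHom g).comp (laurentHom h) := by
  apply AddMonoidAlgebra.algHom_ext
  · intro α
    simp [laurentHom_single, mul_zpow, Finset.prod_mul_distrib, mul_comm]
  · exact Subsingleton.elim _ _

variable (k n) in
/-- The action of the torus on the Laurent polynomial ring by automorphisms. -/
noncomputable def laurentAction : Torus k n →* (Laurent k n ≃ₐ[k] Laurent k n) where
  toFun h := AlgEquiv.ofAlgHom (laurentHom h) (laurentHom h⁻¹)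
    (by rw [← laurentHom_mul, mul_inv_cancel, laurentHom_one])
    (by rw [← laurentHom_mul, inv_mul_cancel, laurentHom_one])
  map_one' := by
    ext1 f
    simp [laurentHom_one]
  map_mul' g h := by
    ext1 f
    simp [laurentHom_mul]

end Laurent

section Affine

variable {k : Type*} [Field k] {n : ℕ}

/-- The algebra endomorphism `f(y₁, …, yₙ) ↦ f(h₁y₁, …, hₙyₙ)` of the polynomial ring. -/
noncomputable def polyHom (h : Torus k n) :
    MvPolynomial (Fin n) k →ₐ[k] MvPolynomial (Fin n) k :=
  MvPolynomial.aeval fun i => MvPolynomial.C (h i : k) * MvPolynomial.X i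

theorem polyHom_one : polyHom (1 : Torus k n) = AlgHom.id k _ := by
  ext1 i
  simp [polyHom]

theorem polyHom_mul (g h : Torus k n) : polyHom (g * h) = (polyHom g).comp (polyHom h) := by
  ext1 i
  simp only [polyHom, AlgHom.comp_apply, MvPolynomial.aeval_X, map_mul, MvPolynomial.aeval_C,
    MvPolynomial.algebraMap_eq, Pi.mul_apply, Units.val_mul]
  ring

variable (k n) in
/-- The action of the torus on the polynomial ring `k[y₁, …, yₙ]` by automorphisms. -/
noncomputable def polyAction :
    Torus k n →* (MvPolynomial (Fin n) k ≃ₐ[k] MvPolynomial (Fin n) k) where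
  toFun h := AlgEquiv.ofAlgHom (polyHom h) (polyHom h⁻¹)
    (by rw [← polyHom_mul, mul_inv_cancel, polyHom_one])
    (by rw [← polyHom_mul, inv_mul_cancel, polyHom_one])
  map_one' := by
    ext1 f
    simp [polyHom_one]
  map_mul' g h := by
    ext1 f
    simp [polyHom_mul]

variable (k) in
/-- `spec_w R`: the prime ideals `P` with `P ∩ {y₁, …, yₙ} = {yᵢ | i ∈ w}`. -/
def specW (w : Set (Fin n)) : Set (Ideal (MvPolynomial (Fin n) k)) :=
  {P | P.IsPrime ∧
    (P : Set (MvPolynomial (Fin n) k)) ∩ Set.range MvPolynomial.X = MvPolynomial.X '' w}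

variable (k) in
/-- `max_w R = max R ∩ spec_w R`. -/
def maxW (w : Set (Fin n)) : Set (Ideal (MvPolynomial (Fin n) k)) :=
  maxIdeals (MvPolynomial (Fin n) k) ∩ specW k w

/-- The compatibility hypothesis on a family `𝒢 = {G_w}` of subgroups of the torus:
`(P : G_v) ⊆ (P : G_w)` for all `v ⊆ w` and all `P ∈ spec_w R`. -/
def Compatible (𝒢 : Set (Fin n) → Subgroup (Torus k n)) : Prop :=
  ∀ v w : Set (Fin n), v ⊆ w → ∀ P ∈ specW k w,
    colon (polyAction k n) (𝒢 v) P ≤ colon (polyAction k n) (𝒢 w) P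

/-- `𝒢-spec_w R = {(P : G_w) | P ∈ spec_w R}`. -/
def familySpecW (𝒢 : Set (Fin n) → Subgroup (Torus k n)) (w : Set (Fin n)) :
    Set (Ideal (MvPolynomial (Fin n) k)) :=
  colon (polyAction k n) (𝒢 w) '' specW k w

/-- `𝒢-spec R`, the set of `𝒢`-prime ideals: the union of the `𝒢-spec_w R`. -/
def familySpec (𝒢 : Set (Fin n) → Subgroup (Torus k n)) :
    Set (Ideal (MvPolynomial (Fin n) k)) :=
  ⋃ w, familySpecW 𝒢 w

/-- `𝒢-max_w R = {(M : G_w) | M ∈ max_w R}`. -/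
def familyMaxW (𝒢 : Set (Fin n) → Subgroup (Torus k n)) (w : Set (Fin n)) :
    Set (Ideal (MvPolynomial (Fin n) k)) :=
  colon (polyAction k n) (𝒢 w) '' maxW k w

/-- `𝒢`-semiprime ideals: intersections of collections of `𝒢`-prime ideals. -/
def IsFamilySemiprime (𝒢 : Set (Fin n) → Subgroup (Torus k n))
    (I : Ideal (MvPolynomial (Fin n) k)) : Prop :=
  ∃ A ⊆ familySpec 𝒢, I = sInf A

/-- `(P : 𝒢)`, the largest `𝒢`-semiprime ideal contained in `P` (formally, the supremum of the
`𝒢`-semiprime ideals contained in `P`; the theorem asserts that it is a maximum). -/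
noncomputable def familyColon (𝒢 : Set (Fin n) → Subgroup (Torus k n))
    (P : Ideal (MvPolynomial (Fin n) k)) : Ideal (MvPolynomial (Fin n) k) :=
  sSup {I | IsFamilySemiprime 𝒢 I ∧ I ≤ P}

variable (k) in
/-- `H_w = {h ∈ H | h_j = 1 for all j ∉ w}`. -/
def coordSubgroup (w : Set (Fin n)) : Subgroup (Torus k n) where
  carrier := {h | ∀ j ∉ w, h j = 1}
  one_mem' := fun _ _ => rfl
  mul_mem' := fun {a b} ha hb j hj => by simp [ha j hj, hb j hj]
  inv_mem' := fun {a} ha j hj => by simp [ha j hj]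

end Affine

end QuantumSpace

/-! Both parts rest on a separation property: if `(M : G) ≤ N`, then `N` lies in the `G`-orbit of
`M`. Given this, `fibers_colon_eq_orbits` and `gMax_eq_image` are formal.

Separation is the Nullstellensatz plus closedness of `G`. Write `M` and `N` as the kernels of
evaluation at points `p` and `q`, with `q = t * p` for some `t` in the torus. If a polynomial `f`
vanishes on `G`, then `F(y) = f(y / p)` vanishes on `G p`, so `F ∈ (M : G) ≤ N` and `f(t) = F(q) =
0`. Since `G` is closed, `t ∈ G`. On the stratum of `w` in affine space, `p` and `q` vanish exactly
at the coordinates in `w`. Those coordinates of `f` are specialised to `1`, which loses nothing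
because `H_w ≤ G`.

In the polynomial case `(M : 𝒢)` is first identified with `(M : G_w)`, by primeness, finiteness of
the set of strata, and compatibility (`IsFamilySemiprime.le_colon`). -/

namespace QuantumSpace

/-! ### Formal properties of `(I : G)`. -/

section Actions

variable {k H R : Type*} [Field k] [Group H] [CommRing R] [Algebra k R]

theorem mem_map_iff (ρ : H →* (R ≃ₐ[k] R)) (g : H) (I : Ideal R) (x : R) :
    x ∈ I.map (ρ g) ↔ ρ g⁻¹ x ∈ I := by
  have h : ∀ y, ρ g (ρ g⁻¹ y) = y := fun y => by
    rw [← AlgEquiv.mul_apply, ← map_mul, mul_inv_cancel, map_one, AlgEquiv.one_apply]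
  have h' : ∀ y, ρ g⁻¹ (ρ g y) = y := fun y => by
    rw [← AlgEquiv.mul_apply, ← map_mul, inv_mul_cancel, map_one, AlgEquiv.one_apply]
  constructor
  · intro hx
    obtain ⟨y, hy, rfl⟩ := (Ideal.mem_map_iff_of_surjective (ρ g) (ρ g).surjective).1 hx
    rwa [h']
  · intro hx
    rw [← h x]
    exact Ideal.mem_map_of_mem _ hx

theorem mem_colon_iff (ρ : H →* (R ≃ₐ[k] R)) (G : Subgroup H) (I : Ideal R) (x : R) :
    x ∈ colon ρ G I ↔ ∀ g ∈ G, ρ g x ∈ I := by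
  simp only [colon, Submodule.mem_iInf, mem_map_iff]
  exact ⟨fun h g hg => by simpa using h g⁻¹ (G.inv_mem hg), fun h g hg => h _ (G.inv_mem hg)⟩

theorem colon_le (ρ : H →* (R ≃ₐ[k] R)) (G : Subgroup H) (I : Ideal R) : colon ρ G I ≤ I := by
  intro x hx
  simpa using (mem_colon_iff ρ G I x).1 hx 1 G.one_mem

theorem apply_mem_colon {ρ : H →* (R ≃ₐ[k] R)} {G : Subgroup H} {I : Ideal R} {x : R}
    (hx : x ∈ colon ρ G I) {g : H} (hg : g ∈ G) : ρ g x ∈ colon ρ G I := by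
  rw [mem_colon_iff] at hx ⊢
  intro g' hg'
  rw [← AlgEquiv.mul_apply, ← map_mul]
  exact hx _ (G.mul_mem hg' hg)

theorem isGIdeal_of_apply_mem {ρ : H →* (R ≃ₐ[k] R)} {G : Subgroup H} {I : Ideal R}
    (h : ∀ g ∈ G, ∀ x ∈ I, ρ g x ∈ I) : IsGIdeal ρ G I := by
  intro g hg
  ext x
  rw [mem_map_iff]
  refine ⟨fun hx => ?_, h _ (G.inv_mem hg) x⟩
  have := h g hg _ hx
  rwa [← AlgEquiv.mul_apply, ← map_mul, mul_inv_cancel, map_one, AlgEquiv.one_apply] at this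

theorem IsGIdeal.apply_mem {ρ : H →* (R ≃ₐ[k] R)} {G : Subgroup H} {I : Ideal R}
    (h : IsGIdeal ρ G I) {g : H} (hg : g ∈ G) {x : R} (hx : x ∈ I) : ρ g x ∈ I := by
  rw [← h g hg]
  exact Ideal.mem_map_of_mem _ hx

theorem isGIdeal_colon (ρ : H →* (R ≃ₐ[k] R)) (G : Subgroup H) (I : Ideal R) :
    IsGIdeal ρ G (colon ρ G I) :=
  isGIdeal_of_apply_mem fun _ hg _ hx => apply_mem_colon hx hg

theorem IsGIdeal.le_colon {ρ : H →* (R ≃ₐ[k] R)} {G : Subgroup H} {I J : Ideal R}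
    (h : IsGIdeal ρ G I) (hIJ : I ≤ J) : I ≤ colon ρ G J :=
  fun _ hx => (mem_colon_iff ρ G J _).2 fun _ hg => hIJ (h.apply_mem hg hx)

theorem isGIdeal_sInf {ρ : H →* (R ≃ₐ[k] R)} {G : Subgroup H} {A : Set (Ideal R)}
    (h : ∀ I ∈ A, IsGIdeal ρ G I) : IsGIdeal ρ G (sInf A) := by
  refine isGIdeal_of_apply_mem fun g hg x hx => ?_
  rw [Submodule.mem_sInf] at hx ⊢
  exact fun I hI => (h I hI).apply_mem hg (hx I hI)

theorem colon_map (ρ : H →* (R ≃ₐ[k] R)) {G : Subgroup H} {g : H} (hg : g ∈ G) (I : Ideal R) :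
    colon ρ G (I.map (ρ g)) = colon ρ G I := by
  ext x
  simp only [mem_colon_iff, mem_map_iff, ← AlgEquiv.mul_apply, ← map_mul]
  refine ⟨fun h g' hg' => ?_, fun h g' hg' => h _ (G.mul_mem (G.inv_mem hg) hg')⟩
  simpa using h (g * g') (G.mul_mem hg hg')

theorem colon_eq_of_mem_orbit {ρ : H →* (R ≃ₐ[k] R)} {G : Subgroup H} {I J : Ideal R}
    (h : J ∈ orbit ρ G I) : colon ρ G J = colon ρ G I := by
  obtain ⟨g, hg, rfl⟩ := h
  exact colon_map ρ hg I

/-- If `G`-orbits of members of a `G`-stable set `s` of ideals are separated by the ideals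
`(I : G)`, then the fibres of `I ↦ (I : G)` on `s` are the `G`-orbits. -/
theorem fibers_colon_eq_orbits {ρ : H →* (R ≃ₐ[k] R)} {G : Subgroup H} {s : Set (Ideal R)}
    (hs : ∀ g ∈ G, ∀ I ∈ s, I.map (ρ g) ∈ s)
    (hsep : ∀ I ∈ s, ∀ J ∈ s, colon ρ G I ≤ J → J ∈ orbit ρ G I) :
    fibers (colon ρ G) s (colon ρ G '' s) = orbits ρ G s := by
  have key : ∀ I ∈ s, {J | J ∈ s ∧ colon ρ G J = colon ρ G I} = orbit ρ G I := by
    intro I hI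
    ext J
    constructor
    · rintro ⟨hJ, h⟩
      exact hsep I hI J hJ (h ▸ colon_le ρ G J)
    · intro hJ
      refine ⟨?_, colon_eq_of_mem_orbit hJ⟩
      obtain ⟨g, hg, rfl⟩ := hJ
      exact hs g hg I hI
  ext F
  constructor
  · rintro ⟨_, ⟨I, hI, rfl⟩, rfl⟩
    exact ⟨I, hI, key I hI⟩
  · rintro ⟨I, hI, rfl⟩
    exact ⟨_, ⟨I, hI, rfl⟩, (key I hI).symm⟩

theorem map_mem_maxIdeals (ρ : H →* (R ≃ₐ[k] R)) (g : H) {M : Ideal R} (hM : M ∈ maxIdeals R) :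
    M.map (ρ g) ∈ maxIdeals R := by
  have : M.IsMaximal := hM
  exact Ideal.map_isMaximal_of_equiv (ρ g)

/-- If `G`-orbits of maximal ideals are separated by the ideals `(M : G)`, then `G-max R` consists
of the ideals `(M : G)`. -/
theorem gMax_eq_image {ρ : H →* (R ≃ₐ[k] R)} {G : Subgroup H}
    (hsep : ∀ M ∈ maxIdeals R, ∀ N ∈ maxIdeals R, colon ρ G M ≤ N → N ∈ orbit ρ G M) :
    gMax ρ G = colon ρ G '' maxIdeals R := by
  have proper : ∀ M ∈ maxIdeals R, colon ρ G M ≠ ⊤ := fun M hM h =>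
    Ideal.IsMaximal.ne_top hM (top_le_iff.1 (h ▸ colon_le ρ G M))
  ext Q
  constructor
  · rintro ⟨⟨hQ, hQt⟩, hmax⟩
    obtain ⟨M, hM, hQM⟩ := Ideal.exists_le_maximal Q hQt
    have hle := hQ.le_colon hQM
    exact ⟨M, hM, le_antisymm (hmax ⟨isGIdeal_colon ρ G M, proper M hM⟩ hle) hle⟩
  · rintro ⟨M, hM, rfl⟩
    refine ⟨⟨isGIdeal_colon ρ G M, proper M hM⟩, fun I ⟨hI, hIt⟩ hle => ?_⟩
    obtain ⟨N, hN, hIN⟩ := Ideal.exists_le_maximal I hIt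
    -- Separation puts `N` in the orbit of `M`, so `(M : G) = (N : G)`, which contains every
    -- `G`-ideal below `N`.
    rw [← colon_eq_of_mem_orbit (hsep M hM N hN (hle.trans hIN))]
    exact hI.le_colon hIN

end Actions

/-- Maximal ideals of a finitely generated algebra over an algebraically closed field are the
kernels of its rational points. -/
theorem exists_eq_ker_of_isMaximal {k A : Type*} [Field k] [IsAlgClosed k] [CommRing A]
    [Algebra k A] [Algebra.FiniteType k A] (M : Ideal A) [hM : M.IsMaximal] :
    ∃ φ : A →ₐ[k] k, M = RingHom.ker φ := by
  let : Field (A ⧸ M) := Ideal.Quotient.field M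
  -- Zariski's lemma: the residue field is finite over `k`, hence equal to `k`.
  have : Module.Finite k (A ⧸ M) := finite_of_finite_type_of_isJacobsonRing k (A ⧸ M)
  let e : k ≃ₐ[k] (A ⧸ M) := AlgEquiv.ofBijective (Algebra.ofId k (A ⧸ M))
    (IsAlgClosed.algebraMap_bijective_of_isIntegral (k := k) (K := A ⧸ M))
  refine ⟨e.symm.toAlgHom.comp (Ideal.Quotient.mkₐ k M), ?_⟩
  ext x
  simp [RingHom.mem_ker, Ideal.Quotient.eq_zero_iff_mem]

/-! ### Closed subgroups of the torus. -/

section Zariski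

variable {k : Type*} [Field k] {n : ℕ}

theorem exists_eq_torusZeros {Z : Set (Torus k n)} (hZ : IsClosed[zariskiTopology k n] Z) :
    ∃ S : Set (MvPolynomial (Fin n) k), Z = torusZeros S := by
  have h : Zᶜᶜ ∈ {Z | ∃ S : Set (MvPolynomial (Fin n) k), Z = torusZeros S} :=
    hZ.isOpen_compl
  rwa [compl_compl] at h

/-- Since `N ≤ G`, the preimage of the image of `G` in the quotient is `G` itself. -/
theorem isClosed_of_isClosed_map_mk {N G : Subgroup (Torus k n)} (hNG : N ≤ G)
    (h : IsClosed[quotientZariskiTopology N]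
      (G.map (QuotientGroup.mk' N) : Set (Torus k n ⧸ N))) :
    IsClosed[zariskiTopology k n] (G : Set (Torus k n)) := by
  have hc := (isClosed_coinduced (t := zariskiTopology k n)).1 h
  rwa [← Subgroup.coe_comap, Subgroup.comap_map_eq_self (by simpa using hNG)] at hc

end Zariski

/-! ### Separation of orbits for Laurent polynomials. -/

section Laurent

variable {k : Type*} [Field k] {n : ℕ}

/-- Evaluation of Laurent polynomials at a point of the torus. -/
noncomputable def laurentEval (p : Torus k n) : Laurent k n →ₐ[k] k :=
  AddMonoidAlgebra.lift k k (Fin n → ℤ)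
    { toFun := fun α => ((∏ i, p i ^ (α.toAdd i) : kˣ) : k)
      map_one' := by simp
      map_mul' := fun α β => by simp [zpow_add₀, Finset.prod_mul_distrib] }

theorem laurentEval_single (p : Torus k n) (α : Fin n → ℤ) (c : k) :
    laurentEval p (AddMonoidAlgebra.single α c) = c * ((∏ i, p i ^ α i : kˣ) : k) := by
  simp [laurentEval, AddMonoidAlgebra.lift_single]

theorem laurentEval_single_basis (p : Torus k n) (i : Fin n) (c : k) :
    laurentEval p (AddMonoidAlgebra.single (Pi.single i 1) c) = c * p i := by
  rw [laurentEval_single, Finset.prod_eq_single i] <;> simp +contextual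

theorem laurentEval_laurentAction (p g : Torus k n) (f : Laurent k n) :
    laurentEval p (laurentAction k n g f) = laurentEval (g * p) f := by
  have : (laurentEval p).comp (laurentHom g) = laurentEval (g * p) := by
    apply AddMonoidAlgebra.algHom_ext
    · intro α
      simp [laurentHom_single, laurentEval_single, mul_zpow, Finset.prod_mul_distrib]
    · exact Subsingleton.elim _ _
  exact DFunLike.congr_fun this f

/-- Monomials are units, so `φ` restricts to a character `ℤⁿ → kˣ`, which is determined by its
values on the standard basis. -/
theorem exists_eq_laurentEval (φ : Laurent k n →ₐ[k] k) : ∃ p, φ = laurentEval p := by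
  let χ : Multiplicative (Fin n → ℤ) →* kˣ :=
    (φ.toMonoidHom.comp (AddMonoidAlgebra.of k (Fin n → ℤ))).toHomUnits
  have hχ : ∀ α : Fin n → ℤ, (χ (.ofAdd α) : k) = φ (AddMonoidAlgebra.single α 1) :=
    fun α => rfl
  refine ⟨fun i => χ (.ofAdd (Pi.single i 1)), ?_⟩
  apply AddMonoidAlgebra.algHom_ext
  · intro α
    rw [laurentEval_single, one_mul, ← hχ]
    congr 1
    conv_lhs => rw [← Finset.univ_sum_single α, ofAdd_sum, map_prod]
    refine Finset.prod_congr rfl fun i _ => ?_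
    rw [← map_zpow, ← ofAdd_zsmul, ← Pi.single_smul, smul_eq_mul, mul_one]
  · exact Subsingleton.elim _ _

theorem laurent_mem_orbit_of_colon_le [IsAlgClosed k] {G : Subgroup (Torus k n)}
    (hG : IsClosed[zariskiTopology k n] (G : Set (Torus k n)))
    {M N : Ideal (Laurent k n)} (hM : M ∈ maxIdeals (Laurent k n))
    (hN : N ∈ maxIdeals (Laurent k n)) (h : colon (laurentAction k n) G M ≤ N) :
    N ∈ orbit (laurentAction k n) G M := by
  obtain ⟨S, hS⟩ := exists_eq_torusZeros hG
  have : M.IsMaximal := hM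
  have : N.IsMaximal := hN
  obtain ⟨φ, rfl⟩ := exists_eq_ker_of_isMaximal (k := k) M
  obtain ⟨ψ, rfl⟩ := exists_eq_ker_of_isMaximal (k := k) N
  obtain ⟨p, rfl⟩ := exists_eq_laurentEval φ
  obtain ⟨q, rfl⟩ := exists_eq_laurentEval ψ
  have hmem : q * p⁻¹ ∈ G := by
    rw [← SetLike.mem_coe, hS]
    intro f hf
    -- `F` is `f` translated by `p⁻¹`, so that it vanishes on the `G`-orbit of `p`.
    let F : Laurent k n := MvPolynomial.aeval
      (fun i => AddMonoidAlgebra.single (Pi.single i (1 : ℤ)) ((p i)⁻¹ : k)) f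
    have hF : ∀ x : Torus k n,
        laurentEval x F = MvPolynomial.eval (fun i => ((x * p⁻¹) i : k)) f := by
      intro x
      rw [← AlgHom.comp_apply, MvPolynomial.comp_aeval, MvPolynomial.aeval_eq_eval]
      simp [laurentEval_single_basis, mul_comm]
    have hFM : F ∈ colon (laurentAction k n) G (RingHom.ker (laurentEval p)) := by
      rw [mem_colon_iff]
      intro g hg
      rw [RingHom.mem_ker, laurentEval_laurentAction, hF, mul_inv_cancel_right]
      rw [← SetLike.mem_coe, hS] at hg
      exact hg f hf
    rw [← hF q]
    exact h hFM
  -- The inverse appears because `g` carries the kernel of evaluation at `p` to that at `g⁻¹ * p`.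
  refine ⟨(q * p⁻¹)⁻¹, G.inv_mem hmem, ?_⟩
  ext x
  rw [mem_map_iff, RingHom.mem_ker, RingHom.mem_ker, laurentEval_laurentAction]
  simp

end Laurent

/-! ### Strata of affine space and families of subgroups. -/

section Affine

variable {k : Type*} [Field k] {n : ℕ}

theorem aeval_polyAction (p : Fin n → k) (g : Torus k n) (f : MvPolynomial (Fin n) k) :
    MvPolynomial.aeval p (polyAction k n g f) =
      MvPolynomial.aeval (fun i => (g i : k) * p i) f := by
  have : (MvPolynomial.aeval p).comp (polyHom g) =
      MvPolynomial.aeval (R := k) (fun i => (g i : k) * p i) := by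
    ext i
    simp [polyHom]
  exact DFunLike.congr_fun this f

theorem polyAction_X (g : Torus k n) (i : Fin n) :
    polyAction k n g (MvPolynomial.X i) = MvPolynomial.C (g i : k) * MvPolynomial.X i := by
  change polyHom g (MvPolynomial.X i) = _
  simp [polyHom]

theorem mem_specW_iff {w : Set (Fin n)} {P : Ideal (MvPolynomial (Fin n) k)} :
    P ∈ specW k w ↔ P.IsPrime ∧ ∀ i, MvPolynomial.X i ∈ P ↔ i ∈ w := by
  refine and_congr_right fun _ => ⟨fun h i => ?_, fun h => ?_⟩
  · have := Set.ext_iff.1 h (MvPolynomial.X i)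
    simpa [MvPolynomial.X_injective.eq_iff] using this
  · ext f
    constructor
    · rintro ⟨hf, i, rfl⟩
      exact ⟨i, (h i).1 hf, rfl⟩
    · rintro ⟨i, hi, rfl⟩
      exact ⟨(h i).2 hi, i, rfl⟩

theorem polyAction_X_mem_iff (g : Torus k n) (i : Fin n) (P : Ideal (MvPolynomial (Fin n) k)) :
    polyAction k n g (MvPolynomial.X i) ∈ P ↔ MvPolynomial.X i ∈ P := by
  rw [polyAction_X]
  exact Ideal.unit_mul_mem_iff_mem P ((g i).isUnit.map MvPolynomial.C)

theorem map_mem_maxW (g : Torus k n) {w : Set (Fin n)} {M : Ideal (MvPolynomial (Fin n) k)}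
    (hM : M ∈ maxW k w) : M.map (polyAction k n g) ∈ maxW k w := by
  have h := map_mem_maxIdeals (polyAction k n) g hM.1
  refine ⟨h, mem_specW_iff.2 ⟨Ideal.IsMaximal.isPrime h, fun i => ?_⟩⟩
  rw [mem_map_iff, polyAction_X_mem_iff, (mem_specW_iff.1 hM.2).2]

theorem poly_mem_orbit_of_colon_le [IsAlgClosed k] {w : Set (Fin n)} {G : Subgroup (Torus k n)}
    (hwG : coordSubgroup k w ≤ G)
    (hG : IsClosed[zariskiTopology k n] (G : Set (Torus k n)))
    {M N : Ideal (MvPolynomial (Fin n) k)} (hM : M ∈ maxW k w) (hN : N ∈ maxW k w)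
    (h : colon (polyAction k n) G M ≤ N) : N ∈ orbit (polyAction k n) G M := by
  classical
  obtain ⟨S, hS⟩ := exists_eq_torusZeros hG
  have : M.IsMaximal := hM.1
  have : N.IsMaximal := hN.1
  obtain ⟨φ, rfl⟩ := exists_eq_ker_of_isMaximal (k := k) M
  obtain ⟨ψ, rfl⟩ := exists_eq_ker_of_isMaximal (k := k) N
  obtain ⟨p, rfl⟩ : ∃ p, φ = MvPolynomial.aeval p := ⟨_, MvPolynomial.aeval_unique φ⟩
  obtain ⟨q, rfl⟩ : ∃ q, ψ = MvPolynomial.aeval q := ⟨_, MvPolynomial.aeval_unique ψ⟩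
  have hp : ∀ i, p i = 0 ↔ i ∈ w := fun i => by
    simpa [RingHom.mem_ker] using (mem_specW_iff.1 hM.2).2 i
  have hq : ∀ i, q i = 0 ↔ i ∈ w := fun i => by
    simpa [RingHom.mem_ker] using (mem_specW_iff.1 hN.2).2 i
  -- Coordinates in `w` are free, as `p` and `q` both vanish there; the value `1` matches the
  -- specialisation used in `F`.
  let t : Torus k n := fun i =>
    if hi : i ∈ w then 1 else Units.mk0 (q i / p i)
      (div_ne_zero (mt (hq i).1 hi) (mt (hp i).1 hi))
  have ht : ∀ i, (t i : k) * p i = q i := by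
    intro i
    by_cases hi : i ∈ w
    · rw [(hp i).2 hi, (hq i).2 hi, mul_zero]
    · simp [t, hi, div_mul_cancel₀ _ (mt (hp i).1 hi)]
  have hmem : t ∈ G := by
    rw [← SetLike.mem_coe, hS]
    intro f hf
    -- Division by `p i` is impossible for `i ∈ w`; those variables of `f` are set to `1`.
    let F : MvPolynomial (Fin n) k := MvPolynomial.aeval
      (fun i => if i ∈ w then 1 else MvPolynomial.C (p i)⁻¹ * MvPolynomial.X i) f
    have hF : ∀ x : Torus k n, MvPolynomial.aeval (fun i => (x i : k) * p i) F =
        MvPolynomial.eval (fun i => if i ∈ w then 1 else (x i : k)) f := by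
      intro x
      rw [← AlgHom.comp_apply, MvPolynomial.comp_aeval, MvPolynomial.aeval_eq_eval]
      congr 2
      ext i
      by_cases hi : i ∈ w
      · simp [hi]
      · have := mt (hp i).1 hi
        simp [hi]
        field_simp
    have hFM : F ∈ colon (polyAction k n) G (RingHom.ker (MvPolynomial.aeval p)) := by
      rw [mem_colon_iff]
      intro g hg
      rw [RingHom.mem_ker, aeval_polyAction, hF]
      -- Multiplying by `c ∈ H_w ≤ G` resets the `w`-coordinates of `g` to `1` without leaving `G`,
      -- so `f` still vanishes there.
      let c : Torus k n := fun i => if i ∈ w then (g i)⁻¹ else 1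
      have hc : c ∈ coordSubgroup k w := fun j hj => by simp [c, hj]
      have hgc : g * c ∈ torusZeros S := hS ▸ G.mul_mem hg (hwG hc)
      convert hgc f hf using 3 with i
      ext i
      by_cases hi : i ∈ w <;> simp [c, hi]
    have h0 := h hFM
    rw [RingHom.mem_ker] at h0
    rw [← funext ht, hF] at h0
    convert h0 using 3
    ext i
    by_cases hi : i ∈ w <;> simp [t, hi]
  refine ⟨t⁻¹, G.inv_mem hmem, ?_⟩
  ext x
  rw [mem_map_iff, RingHom.mem_ker, RingHom.mem_ker, inv_inv, aeval_polyAction, funext ht]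

/-- A `𝒢`-semiprime ideal contained in a prime `P ∈ spec_w R` is contained in `(P : G_w)`. -/
theorem IsFamilySemiprime.le_colon {𝒢 : Set (Fin n) → Subgroup (Torus k n)} (h𝒢 : Compatible 𝒢)
    {w : Set (Fin n)} {I P : Ideal (MvPolynomial (Fin n) k)} (hI : IsFamilySemiprime 𝒢 I)
    (hP : P ∈ specW k w) (hIP : I ≤ P) : I ≤ colon (polyAction k n) (𝒢 w) P := by
  obtain ⟨A, hA, rfl⟩ := hI
  -- Grouping the members of `A` by stratum turns an arbitrary intersection into a finite one, so
  -- the prime `P` contains some `J v`.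
  let J : Set (Fin n) → Ideal (MvPolynomial (Fin n) k) := fun v => sInf (A ∩ familySpecW 𝒢 v)
  have hJ : ⨅ v, J v ≤ P := by
    refine le_trans (le_sInf fun K hK => ?_) hIP
    obtain ⟨v, hv⟩ := Set.mem_iUnion.1 (hA hK)
    exact (iInf_le J v).trans (sInf_le ⟨hK, hv⟩)
  obtain ⟨v, hv⟩ : ∃ v, J v ≤ P := by
    rw [← Finset.inf_univ_eq_iInf, Ideal.IsPrime.inf_le' hP.1] at hJ
    simpa using hJ
  -- The variables are eigenvectors of the torus, so those indexed by `v` survive in each `(Q :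
  -- G_v)`, hence in `J v ≤ P`.
  have hvw : v ⊆ w := by
    intro i hi
    refine ((mem_specW_iff.1 hP).2 i).1 (hv ?_)
    refine Submodule.mem_sInf.2 ?_
    rintro _ ⟨-, Q, hQ, rfl⟩
    refine (mem_colon_iff _ _ _ _).2 fun g _ => ?_
    exact (polyAction_X_mem_iff g i Q).2 (((mem_specW_iff.1 hQ).2 i).2 hi)
  have hGJ : IsGIdeal (polyAction k n) (𝒢 v) (J v) := by
    refine isGIdeal_sInf ?_
    rintro _ ⟨-, Q, -, rfl⟩
    exact isGIdeal_colon _ _ _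
  -- The chain is `I ≤ J v ≤ (P : G_v) ≤ (P : G_w)`, the last step by compatibility.
  exact (sInf_le_sInf Set.inter_subset_left).trans
    ((hGJ.le_colon hv).trans (h𝒢 v w hvw P hP))

theorem isGreatest_colon {𝒢 : Set (Fin n) → Subgroup (Torus k n)} (h𝒢 : Compatible 𝒢)
    {w : Set (Fin n)} {P : Ideal (MvPolynomial (Fin n) k)} (hP : P ∈ specW k w) :
    IsGreatest {I | IsFamilySemiprime 𝒢 I ∧ I ≤ P} (colon (polyAction k n) (𝒢 w) P) := by
  refine ⟨⟨⟨{colon (polyAction k n) (𝒢 w) P}, ?_, sInf_singleton.symm⟩, colon_le _ _ _⟩,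
    fun I hI => hI.1.le_colon h𝒢 hP hI.2⟩
  exact Set.singleton_subset_iff.2 (Set.mem_iUnion.2 ⟨w, P, hP, rfl⟩)

theorem familyColon_eq_colon {𝒢 : Set (Fin n) → Subgroup (Torus k n)} (h𝒢 : Compatible 𝒢)
    {w : Set (Fin n)} {P : Ideal (MvPolynomial (Fin n) k)} (hP : P ∈ specW k w) :
    familyColon 𝒢 P = colon (polyAction k n) (𝒢 w) P :=
  (isGreatest_colon h𝒢 hP).isLUB.sSup_eq

end Affine

theorem fibers_congr {α β : Type*} {f g : α → β} {s : Set α} (t : Set β) (h : Set.EqOn f g s) :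
    fibers f s t = fibers g s t := by
  have : ∀ Q, {M | M ∈ s ∧ f M = Q} = {M | M ∈ s ∧ g M = Q} := fun Q =>
    Set.ext fun M => and_congr_right fun hM => by rw [h hM]
  simp only [fibers, this]

end QuantumSpace

theorem proposition2p7 {k : Type*} [Field k] [IsAlgClosed k] (n : ℕ) :
    -- closed subgroups of a torus acting on a Laurent polynomial ring
    (∀ G : Subgroup (QuantumSpace.Torus k n),
      IsClosed[QuantumSpace.zariskiTopology k n] (G : Set (QuantumSpace.Torus k n)) →
      Set.MapsTo (QuantumSpace.colon (QuantumSpace.laurentAction k n) G)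
        (QuantumSpace.maxIdeals (QuantumSpace.Laurent k n))
        (QuantumSpace.gMax (QuantumSpace.laurentAction k n) G) ∧
      QuantumSpace.fibers (QuantumSpace.colon (QuantumSpace.laurentAction k n) G)
        (QuantumSpace.maxIdeals (QuantumSpace.Laurent k n))
        (QuantumSpace.gMax (QuantumSpace.laurentAction k n) G) =
      QuantumSpace.orbits (QuantumSpace.laurentAction k n) G
        (QuantumSpace.maxIdeals (QuantumSpace.Laurent k n))) ∧
    -- compatible families of subgroups acting piecewise on a polynomial ring
    (∀ 𝒢 : Set (Fin n) → Subgroup (QuantumSpace.Torus k n), QuantumSpace.Compatible 𝒢 →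
      ∀ w : Set (Fin n), QuantumSpace.coordSubgroup k w ≤ 𝒢 w →
      IsClosed[QuantumSpace.quotientZariskiTopology (QuantumSpace.coordSubgroup k w)]
        ((𝒢 w).map (QuotientGroup.mk' (QuantumSpace.coordSubgroup k w)) :
          Set (QuantumSpace.Torus k n ⧸ QuantumSpace.coordSubgroup k w)) →
      (∀ M ∈ QuantumSpace.maxW k w,
        IsGreatest {I | QuantumSpace.IsFamilySemiprime 𝒢 I ∧ I ≤ M}
          (QuantumSpace.familyColon 𝒢 M)) ∧
      Set.MapsTo (QuantumSpace.familyColon 𝒢) (QuantumSpace.maxW k w)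
        (QuantumSpace.familyMaxW 𝒢 w) ∧
      QuantumSpace.fibers (QuantumSpace.familyColon 𝒢) (QuantumSpace.maxW k w)
        (QuantumSpace.familyMaxW 𝒢 w) =
      QuantumSpace.orbits (QuantumSpace.polyAction k n) (𝒢 w) (QuantumSpace.maxW k w)) := by
  refine ⟨fun G hG => ?_, fun 𝒢 h𝒢 w hw hcl => ?_⟩
  · have hsep := fun M hM N hN =>
      QuantumSpace.laurent_mem_orbit_of_colon_le (M := M) (N := N) hG hM hN
    rw [QuantumSpace.gMax_eq_image hsep]
    exact ⟨Set.mapsTo_image _ _, QuantumSpace.fibers_colon_eq_orbits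
      (fun g _ _ hI => QuantumSpace.map_mem_maxIdeals _ g hI) hsep⟩
  · have heq : Set.EqOn (QuantumSpace.familyColon 𝒢)
        (QuantumSpace.colon (QuantumSpace.polyAction k n) (𝒢 w)) (QuantumSpace.maxW k w) :=
      fun M hM => QuantumSpace.familyColon_eq_colon h𝒢 hM.2
    refine ⟨fun M hM => ?_, fun M hM => ⟨M, hM, (heq hM).symm⟩, ?_⟩
    · rw [heq hM]
      exact QuantumSpace.isGreatest_colon h𝒢 hM.2
    · rw [QuantumSpace.fibers_congr _ heq]
      exact QuantumSpace.fibers_colon_eq_orbits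
        (fun g _ _ hI => QuantumSpace.map_mem_maxW g hI)
        fun M hM N hN => QuantumSpace.poly_mem_orbit_of_colon_le hw
          (QuantumSpace.isClosed_of_isClosed_map_mk hw hcl) hM hN
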